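/- Let $r\ge 3$. An $r$-graph $G$ on $n$ vertices is a set of $r$-element subsets (edges) of an $n$-element vertex set; it has density $p$ if it has exactly $p\binom nr$ edges. For a set $W$ of vertices, the density of $G[W]$ is the number of edges contained in $W$ divided by $\binom{|W|}{r}$. $G$ is $(\varepsilon,p)$-quasi-random if it has density $p$ and, for every set $W$ of exactly $\lfloor n/2\rfloor$ vertices, the density of $G[W]$ lies in $(p-\varepsilon,p+\varepsilon)$. A Hamiltonian cycle of $G$ is given by an ordering $v_1,\dots,v_n$ of the vertices such that $\{v_i,\dots,v_{i+r-1}\}$ is an edge for every $i=1,\dots,n$ (indices modulo $n$), and is identified with its set of edges. Let $H_r(n,p,\varepsilon)$ be the maximum number of Hamiltonian cycles in an $(\varepsilon,p)$-quasi-random $r$-graph on $n$ vertices, and let $E(n,p)=p^n\,(n-1)!/2$. **Theorem.** Let $\varepsilon>0$, $p\in(0,1)$ and $r\ge 3$ be fixed, and set $\gamma_3=\frac13$ and $\gamma_r=\frac12$ for $r\ge4$. Below, $n$ ranges over the positive integers for which $p\binom nr$ is an integer. (a) There are real numbers $\gamma(n)$ with $\gamma(n)\to\gamma_r$ as $n\to\infty$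 and a constant $c>0$ such that, for all sufficiently large such $n$, an $(\varepsilon,p)$-quasi-random $r$-graph on $n$ vertices exists and $$\frac{H_r(n,p,\varepsilon)}{E(n,p)}\ \ge\ 2^{\,c\,n^{\gamma(n)}}.$$ (b) Equivalently, for every fixed $\delta>0$ there is a constant $c>0$ such that, for all sufficiently large such $n$, an $(\varepsilon,p)$-quasi-random $r$-graph on $n$ vertices exists and $$\frac{H_r(n,p,\varepsilon)}{E(n,p)}\ \ge\ 2^{\,c\,n^{\gamma_r-3\delta}}.$$ The constants $c$, the thresholds for $n$, and $\gamma(\cdot)$ may depend on $\varepsilon,p,r$ (and in (b) on $\delta$). -/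

import Mathlib

open Filter Topology

/-- A finite simple `r`-graph on the vertex set `Fin n`: a set of `r`-element subsets. -/
structure RGraph (r n : ℕ) where
  edges : Finset (Finset (Fin n))
  uniform : ∀ e ∈ edges, e.card = r

namespace RGraph

/-- `{v_i, v_{i+1}, …, v_{i+r-1}}` for the ordering `v = π` of the vertices, with indices taken
modulo `n`. -/
def window (r : ℕ) {n : ℕ} (π : Equiv.Perm (Fin n)) (i : Fin n) : Finset (Fin n) :=
  (Finset.range r).image fun j => π ⟨(i.val + j) % n, Nat.mod_lt _ i.pos⟩

/-- The `r`-set of a permutation: the set of all its cyclic windows of length `r`, that is, the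
edge set of the corresponding Hamiltonian cycle of the complete `r`-graph. -/
def rSet (r : ℕ) {n : ℕ} (π : Equiv.Perm (Fin n)) : Finset (Finset (Fin n)) :=
  Finset.univ.image (window r π)

/-- The Hamiltonian cycles of `G`, each one identified with its set of edges (so that rotations
and reversals of an ordering are not counted separately). -/
def hamCycles {r n : ℕ} (G : RGraph r n) : Finset (Finset (Finset (Fin n))) :=
  (Finset.univ.image (rSet r)).filter (· ⊆ G.edges)

/-- `H(G)`, the number of Hamiltonian cycles of `G`. -/
def hamCount {r n : ℕ} (G : RGraph r n) : ℕ := G.hamCycles.card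

/-- `G` has density `p`: it has exactly `p * (n choose r)` edges. -/
def HasDensity {r n : ℕ} (G : RGraph r n) (p : ℝ) : Prop :=
  (G.edges.card : ℝ) = p * (n.choose r : ℝ)

/-- The density of the sub-`r`-graph `G[W]` induced by a set `W` of at least `r` vertices. -/
noncomputable def inducedDensity {r n : ℕ} (G : RGraph r n) (W : Finset (Fin n)) : ℝ :=
  ((G.edges.filter (· ⊆ W)).card : ℝ) / (W.card.choose r : ℝ)

/-- `(ε, p)`-quasi-randomness: `G` has density exactly `p`, and every set of `⌊n/2⌋` vertices
induces a subgraph whose density lies in the open interval `(p - ε, p + ε)`. -/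
def IsQuasiRandom {r n : ℕ} (G : RGraph r n) (ε p : ℝ) : Prop :=
  G.HasDensity p ∧
    ∀ W : Finset (Fin n), W.card = n / 2 → G.inducedDensity W ∈ Set.Ioo (p - ε) (p + ε)

/-- The numbers of Hamiltonian cycles of the `(ε, p)`-quasi-random `r`-graphs on `n` vertices. -/
def hamCounts (r n : ℕ) (p ε : ℝ) : Set ℕ :=
  {h | ∃ G : RGraph r n, G.IsQuasiRandom ε p ∧ G.hamCount = h}

theorem bddAbove_hamCounts (r n : ℕ) (p ε : ℝ) : BddAbove (hamCounts r n p ε) := by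
  refine ⟨((Finset.univ : Finset (Equiv.Perm (Fin n))).image (rSet r)).card, ?_⟩
  rintro h ⟨G, -, rfl⟩
  exact Finset.card_le_card (Finset.filter_subset _ _)

end RGraph

/-- `H_r(n, p, ε)`: the maximum of `H(G)` over all `(ε, p)`-quasi-random `r`-graphs `G` on `n`
vertices. The set of values is bounded by `RGraph.bddAbove_hamCounts`, so the supremum is a maximum
as soon as there is such a `G`; it is `0` if there is none. -/
noncomputable def maxHam (r n : ℕ) (p ε : ℝ) : ℕ := sSup (RGraph.hamCounts r n p ε)

/-- The expectation value `E(n, p) = p ^ n * (n - 1)! / 2` (for `n ≥ 1`). -/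
noncomputable def expectedHam (n : ℕ) (p : ℝ) : ℝ := p ^ n * ((n - 1).factorial : ℝ) / 2

/-- The limiting exponent: `1/3` for `r = 3`, and `1/2` for `r ≥ 4`. -/
noncomputable def limitExponent (r : ℕ) : ℝ := if r = 3 then 1 / 3 else 1 / 2

/-- `H_r(n, p, ε) / E(n, p) ≥ 2 ^ Ω(n ^ γ(n))`, as `n` tends to infinity through the integers for
which `p * (n choose r)` is an integer. -/
def HamRatioLowerBound (r : ℕ) (p ε : ℝ) (γ : ℕ → ℝ) : Prop :=
  ∃ c : ℝ, 0 < c ∧ ∃ n₀ : ℕ, ∀ n : ℕ, n₀ ≤ n → (∃ m : ℕ, (m : ℝ) = p * (n.choose r : ℝ)) →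
    (2 : ℝ) ^ (c * (n : ℝ) ^ γ n) ≤ (maxHam r n p ε : ℝ) / expectedHam n p

/-!
The ratio is in fact exponentially large: `maxHam r n p ε / expectedHam n p ≥ 2 ^ (c * n)` for a
constant `c > 0` (`eventually_exp_le_maxHam_div`), and since `limitExponent r ≤ 1`, both parts
follow at once.

The graph is random. Attach independent uniform signs `z s = ±1` to the `(r - 1)`-sets `s` of
vertices and, given the signs, select each `r`-set `e` independently with probability
`q * (1 + η * ∑ z s)`, the sum being over the `(r - 1)`-subsets `s` of `e`.

* *Gain.* The probability that the graph contains a given Hamiltonian cycle is `q ^ n` times the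
  expectation of `∏ (1 + η * ∑ z s)` over its `n` edges. All monomials in signs have nonnegative
  expectation, and two consecutive edges share an `(r - 1)`-set, whose sign squared contributes
  `η ^ 2`; so pairing consecutive edges gives the lower bound `(1 + η ^ 2) ^ ⌊n / 2⌋`
  (`SignModel.card_mul_pow_le_sum_prod`).
* *Quasi-randomness.* A sign influences at most `n` edges, so an exponential moment over signs and
  edges together shows that the number of edges inside a given set of at least `n / 2` vertices is
  off by a constant factor with probability at most `exp (-c * n ^ (r - 1))`
  (`SignModel.sum_mixWeight_tail_le`). As `r ≥ 3`, this beats the `2 ^ n` vertex sets and any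
  factor exponential in `n`, so discarding the exceptional outcomes does not affect the gain
  (`RGraph.exists_isUniform`).
* *Exact density.* Take `q = p - 2 * κ` with `κ` small; the graph then has fewer than
  `p * (n choose r)` edges, and adding arbitrary edges only creates Hamiltonian cycles and changes
  the induced densities by `O(κ)` (`RGraph.exists_isQuasiRandom_of_isUniform`). The loss
  `(q / p) ^ n` is smaller than the gain.
* *Distinct cycles.* At most `n ^ r` orderings give the same cycle
  (`RGraph.card_perm_le_hamCount_mul`), a polynomial factor.
-/

/-! ### Nonnegative polynomials in independent signs -/

namespace SignModel

/-- The sign attached to `s`, as a real-valued function of the sign pattern. -/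
def sgn {ι : Type*} (s : ι) : (ι → ℤˣ) → ℝ := fun z => ((z s : ℤ) : ℝ)

/-- The functions of a sign pattern that are polynomials with nonnegative coefficients in the
signs. -/
def posCone (ι : Type*) : Subsemiring ((ι → ℤˣ) → ℝ) :=
  Subsemiring.closure ({F | ∃ c : ℝ, 0 ≤ c ∧ F = fun _ => c} ∪ Set.range sgn)

theorem const_mem_posCone {ι : Type*} {c : ℝ} (hc : 0 ≤ c) :
    (fun _ => c : (ι → ℤˣ) → ℝ) ∈ posCone ι :=
  Subsemiring.subset_closure (Or.inl ⟨c, hc, rfl⟩)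

theorem sgn_mem_posCone {ι : Type*} (s : ι) : sgn s ∈ posCone ι :=
  Subsemiring.subset_closure (Or.inr ⟨s, rfl⟩)

theorem sgn_mul_self {ι : Type*} (s : ι) : sgn s * sgn s = fun _ => 1 := by
  funext z
  rcases Int.units_eq_one_or (z s) with h | h <;> simp [sgn, h]

theorem abs_sgn {ι : Type*} (s : ι) (z : ι → ℤˣ) : |sgn s z| = 1 := by
  rcases Int.units_eq_one_or (z s) with h | h <;> simp [sgn, h]

theorem sum_units {M : Type*} [AddCommMonoid M] (f : ℤˣ → M) : ∑ u, f u = f 1 + f (-1) := by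
  rw [show (Finset.univ : Finset ℤˣ) = {1, -1} from rfl, Finset.sum_pair (by decide)]

theorem card_signs {ι : Type*} [Fintype ι] [DecidableEq ι] :
    (Fintype.card (ι → ℤˣ) : ℝ) = ∏ _s : ι, 2 := by
  simp

/-- A polynomial in independent uniform signs with nonnegative coefficients has nonnegative
expectation: a monomial averages to `1` or `0` according to the parity of its exponents. -/
theorem sum_nonneg_of_mem_posCone {ι : Type*} [Fintype ι] [DecidableEq ι]
    {F : (ι → ℤˣ) → ℝ} (hF : F ∈ posCone ι) : 0 ≤ ∑ z, F z := by
  have hmono : ∀ M ∈ Submonoid.closure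
      ({F : (ι → ℤˣ) → ℝ | ∃ c : ℝ, 0 ≤ c ∧ F = fun _ => c} ∪ Set.range sgn),
      ∃ c : ℝ, 0 ≤ c ∧ ∃ k : ι → ℕ, M = fun z => c * ∏ s, sgn s z ^ k s := by
    intro M hM
    induction hM using Submonoid.closure_induction with
    | mem x hx =>
      rcases hx with ⟨c, hc, rfl⟩ | ⟨s, rfl⟩
      · exact ⟨c, hc, 0, by simp⟩
      · refine ⟨1, zero_le_one, Pi.single s 1, ?_⟩
        funext z
        rw [one_mul, Finset.prod_eq_single s]
        · simp
        · intro t _ hts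
          simp [hts]
        · simp
    | one => exact ⟨1, zero_le_one, 0, by funext z; simp⟩
    | mul x y _ _ hx hy =>
      obtain ⟨c, hc, k, rfl⟩ := hx
      obtain ⟨d, hd, l, rfl⟩ := hy
      refine ⟨c * d, mul_nonneg hc hd, k + l, ?_⟩
      funext z
      simp only [Pi.mul_apply, Pi.add_apply, pow_add, Finset.prod_mul_distrib]
      ring
  rw [posCone, Subsemiring.mem_closure_iff] at hF
  induction hF using AddSubmonoid.closure_induction with
  | mem x hx =>
    obtain ⟨c, hc, k, rfl⟩ := hmono x hx
    rw [← Finset.mul_sum]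
    refine mul_nonneg hc ?_
    have h := Fintype.prod_sum (fun (s : ι) (u : ℤˣ) => (((u : ℤ) : ℝ)) ^ k s)
    simp only [sgn]
    rw [← h]
    refine Finset.prod_nonneg fun s _ => ?_
    rw [sum_units]
    rcases Nat.even_or_odd (k s) with hk | hk <;> simp [hk.neg_one_pow]
  | zero => simp
  | add x y _ _ hx hy =>
    simp only [Pi.add_apply, Finset.sum_add_distrib]
    exact add_nonneg hx hy

/-- `F` is `m` plus a polynomial with nonnegative coefficients in the signs. -/
def Exceeds {ι : Type*} (F : (ι → ℤˣ) → ℝ) (m : ℝ) : Prop :=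
  ∃ R ∈ posCone ι, F = (fun _ => m) + R

theorem Exceeds.mul {ι : Type*} {F H : (ι → ℤˣ) → ℝ} {m k : ℝ} (hm : 0 ≤ m) (hk : 0 ≤ k)
    (hF : Exceeds F m) (hH : Exceeds H k) : Exceeds (F * H) (m * k) := by
  obtain ⟨R, hR, rfl⟩ := hF
  obtain ⟨S, hS, rfl⟩ := hH
  refine ⟨(fun _ => m) * S + R * (fun _ => k) + R * S, ?_, ?_⟩
  · exact add_mem (add_mem (mul_mem (const_mem_posCone hm) hS)
      (mul_mem hR (const_mem_posCone hk))) (mul_mem hR hS)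
  · funext z
    simp only [Pi.mul_apply, Pi.add_apply]
    ring

theorem exceeds_one_add {ι : Type*} {η : ℝ} (hη : 0 ≤ η) (A : Finset ι) :
    Exceeds (fun z => 1 + η * ∑ s ∈ A, sgn s z) 1 := by
  refine ⟨(fun _ => η) * ∑ s ∈ A, sgn s, mul_mem (const_mem_posCone hη)
    (sum_mem fun s _ => sgn_mem_posCone s), ?_⟩
  funext z
  simp

/-- Two factors that share a sign are positively correlated. -/
theorem exceeds_mul_of_common {ι : Type*} [DecidableEq ι] {η : ℝ} (hη : 0 ≤ η) {A B : Finset ι}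
    {s : ι} (hA : s ∈ A) (hB : s ∈ B) :
    Exceeds ((fun z => 1 + η * ∑ s ∈ A, sgn s z) * (fun z => 1 + η * ∑ s ∈ B, sgn s z))
      (1 + η ^ 2) := by
  set a : (ι → ℤˣ) → ℝ := ∑ t ∈ A.erase s, sgn t with ha
  set b : (ι → ℤˣ) → ℝ := ∑ t ∈ B.erase s, sgn t with hb
  have hac : a ∈ posCone ι := sum_mem fun s _ => sgn_mem_posCone s
  have hbc : b ∈ posCone ι := sum_mem fun s _ => sgn_mem_posCone s
  have hs := sgn_mem_posCone s
  have hc : (fun _ => η : (ι → ℤˣ) → ℝ) ∈ posCone ι := const_mem_posCone hη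
  refine ⟨(fun _ => η) * (sgn s + sgn s + a + b)
    + (fun _ => η) * (fun _ => η) * (sgn s * b + a * sgn s + a * b), ?_, ?_⟩
  · exact add_mem (mul_mem hc (add_mem (add_mem (add_mem hs hs) hac) hbc))
      (mul_mem (mul_mem hc hc) (add_mem (add_mem (mul_mem hs hbc) (mul_mem hac hs))
        (mul_mem hac hbc)))
  · funext z
    have h1 : ∑ t ∈ A, sgn t z = sgn s z + a z := by
      rw [ha, Finset.sum_apply, Finset.add_sum_erase A (fun t => sgn t z) hA]
    have h2 : ∑ t ∈ B, sgn t z = sgn s z + b z := by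
      rw [hb, Finset.sum_apply, Finset.add_sum_erase B (fun t => sgn t z) hB]
    have h3 : sgn s z * sgn s z = 1 := congrFun (sgn_mul_self s) z
    simp only [Pi.mul_apply, Pi.add_apply, h1, h2]
    linear_combination η ^ 2 * h3

/-- The exponential gain: if the factors `2k` and `2k + 1` share a sign for every `k`, then the
expectation of the product is at least `(1 + η ^ 2) ^ ⌊n / 2⌋`. -/
theorem card_mul_pow_le_sum_prod {ι : Type*} [Fintype ι] [DecidableEq ι] {η : ℝ} (hη : 0 ≤ η)
    (A : ℕ → Finset ι) (n : ℕ)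
    (hA : ∀ k, 2 * k + 1 < n → ∃ s, s ∈ A (2 * k) ∧ s ∈ A (2 * k + 1)) :
    (Fintype.card (ι → ℤˣ) : ℝ) * (1 + η ^ 2) ^ (n / 2) ≤
      ∑ z, ∏ i ∈ Finset.range n, (1 + η * ∑ s ∈ A i, sgn s z) := by
  have hpos : (0 : ℝ) ≤ 1 + η ^ 2 := by positivity
  have heven : ∀ m, 2 * m ≤ n → Exceeds
      (fun z => ∏ i ∈ Finset.range (2 * m), (1 + η * ∑ s ∈ A i, sgn s z))
      ((1 + η ^ 2) ^ m) := by
    intro m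
    induction m with
    | zero => exact fun _ => ⟨0, zero_mem _, by funext z; simp⟩
    | succ m ih =>
      intro hm
      obtain ⟨s, h1, h2⟩ := hA m (by omega)
      have := (ih (by omega)).mul (pow_nonneg hpos m) hpos (exceeds_mul_of_common hη h1 h2)
      rw [pow_succ]
      convert this using 1
      funext z
      rw [show 2 * (m + 1) = 2 * m + 1 + 1 by ring, Finset.prod_range_succ,
        Finset.prod_range_succ]
      simp only [Pi.mul_apply]
      ring
  have hall : Exceeds (fun z => ∏ i ∈ Finset.range n, (1 + η * ∑ s ∈ A i, sgn s z))
      ((1 + η ^ 2) ^ (n / 2)) := by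
    have h := heven (n / 2) (by omega)
    rcases Nat.even_or_odd' n with ⟨k, rfl | rfl⟩
    · rwa [show 2 * k / 2 = k by omega] at h ⊢
    · rw [show (2 * k + 1) / 2 = k by omega] at h ⊢
      have := h.mul (pow_nonneg hpos k) zero_le_one (exceeds_one_add hη (A (2 * k)))
      rw [mul_one] at this
      convert this using 1
      funext z
      rw [Finset.prod_range_succ]
      rfl
  obtain ⟨R, hR, hR'⟩ := hall
  rw [hR']
  simp only [Pi.add_apply, Finset.sum_add_distrib, Finset.sum_const, Finset.card_univ,
    nsmul_eq_mul]
  exact le_add_of_nonneg_right (sum_nonneg_of_mem_posCone hR)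

/-! ### Random edge sets driven by signs -/

/-- The probability of the outcome `G` when each element `e` of `U` is selected independently with
probability `p e`. -/
def bernoulliWeight {E : Type*} [DecidableEq E] (U : Finset E) (p : E → ℝ) (G : Finset E) : ℝ :=
  (∏ e ∈ G, p e) * ∏ e ∈ U \ G, (1 - p e)

theorem sum_bernoulliWeight_mul {E : Type*} [DecidableEq E] (U : Finset E) (p a b : E → ℝ) :
    ∑ G ∈ U.powerset, bernoulliWeight U p G * ((∏ e ∈ G, a e) * ∏ e ∈ U \ G, b e) =
      ∏ e ∈ U, (p e * a e + (1 - p e) * b e) := by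
  rw [Finset.prod_add]
  refine Finset.sum_congr rfl fun G _ => ?_
  rw [bernoulliWeight, Finset.prod_mul_distrib, Finset.prod_mul_distrib]
  ring

theorem sum_bernoulliWeight_superset {E : Type*} [DecidableEq E] {U C : Finset E} (hC : C ⊆ U)
    (p : E → ℝ) :
    ∑ G ∈ U.powerset with C ⊆ G, bernoulliWeight U p G = ∏ e ∈ C, p e := by
  have h := sum_bernoulliWeight_mul U p (fun _ => 1) (fun e => if e ∈ C then 0 else 1)
  have h2 : ∏ e ∈ U, (p e * 1 + (1 - p e) * if e ∈ C then 0 else 1) = ∏ e ∈ C, p e := by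
    rw [← Finset.prod_subset hC]
    · exact Finset.prod_congr rfl fun e he => by simp [he]
    · intro e _ he
      simp [he]
  rw [h2] at h
  rw [← h, Finset.sum_filter]
  refine Finset.sum_congr rfl fun G hG => ?_
  split_ifs with hCG
  · rw [Finset.prod_eq_one, Finset.prod_eq_one]
    · simp
    · intro e he
      rw [if_neg]
      exact fun h => (Finset.mem_sdiff.1 he).2 (hCG h)
    · simp
  · obtain ⟨e, heC, heG⟩ := Finset.not_subset.1 hCG
    rw [Finset.prod_eq_zero (s := U \ G) (i := e) (Finset.mem_sdiff.2 ⟨hC heC, heG⟩)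
      (by simp [heC])]
    simp

theorem sum_bernoulliWeight_mul_pow {E : Type*} [DecidableEq E] {U S : Finset E} (hS : S ⊆ U)
    (p : E → ℝ) (t : ℝ) :
    ∑ G ∈ U.powerset, bernoulliWeight U p G * t ^ (G ∩ S).card =
      ∏ e ∈ S, (1 + p e * (t - 1)) := by
  have h := sum_bernoulliWeight_mul U p (fun e => if e ∈ S then t else 1) (fun _ => 1)
  have h2 : ∏ e ∈ U, ((p e * if e ∈ S then t else 1) + (1 - p e) * 1) =
      ∏ e ∈ S, (1 + p e * (t - 1)) := by
    rw [← Finset.prod_subset hS]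
    · exact Finset.prod_congr rfl fun e he => by simp [he]; ring
    · intro e _ he
      simp [he]
  rw [h2] at h
  rw [← h]
  refine Finset.sum_congr rfl fun G hG => ?_
  simp [Finset.prod_ite_mem]

/-- The conditional probability of `e` given the signs: it is tilted by the signs in `d e`. -/
def edgeProb {E ι : Type*} (d : E → Finset ι) (q η : ℝ) (z : ι → ℤˣ) (e : E) : ℝ :=
  q * (1 + η * ∑ s ∈ d e, sgn s z)

/-- The law of the random subset of `U` obtained by choosing uniform independent signs and then
selecting every `e ∈ U` independently with probability `edgeProb d q η z e`. -/
noncomputable def mixWeight {E ι : Type*} [DecidableEq E] [Fintype ι] [DecidableEq ι]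
    (U : Finset E) (d : E → Finset ι) (q η : ℝ) (G : Finset E) : ℝ :=
  (Fintype.card (ι → ℤˣ) : ℝ)⁻¹ * ∑ z, bernoulliWeight U (edgeProb d q η z) G

theorem abs_sum_sgn_le {ι : Type*} (A : Finset ι) (z : ι → ℤˣ) :
    |∑ s ∈ A, sgn s z| ≤ A.card := by
  refine (Finset.abs_sum_le_sum_abs _ _).trans ?_
  simp [abs_sgn]

theorem edgeProb_mem_Icc {E ι : Type*} {d : E → Finset ι} {q η : ℝ} {r : ℕ} {e : E}
    (hq : 0 ≤ q) (hη : 0 ≤ η) (hr : η * r ≤ 1) (hqr : q * (1 + η * r) ≤ 1)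
    (he : (d e).card = r) (z : ι → ℤˣ) : edgeProb d q η z e ∈ Set.Icc (0 : ℝ) 1 := by
  have h := abs_le.1 (abs_sum_sgn_le (d e) z)
  rw [he] at h
  have h1 : η * -(r : ℝ) ≤ η * ∑ s ∈ d e, sgn s z := mul_le_mul_of_nonneg_left h.1 hη
  have h2 : η * ∑ s ∈ d e, sgn s z ≤ η * (r : ℝ) := mul_le_mul_of_nonneg_left h.2 hη
  exact ⟨mul_nonneg hq (by linarith),
    (mul_le_mul_of_nonneg_left (by linarith) hq).trans hqr⟩

theorem mixWeight_nonneg {E ι : Type*} [DecidableEq E] [Fintype ι] [DecidableEq ι]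
    {U : Finset E} {d : E → Finset ι} {q η : ℝ} {r : ℕ} (hq : 0 ≤ q) (hη : 0 ≤ η)
    (hr : η * r ≤ 1) (hqr : q * (1 + η * r) ≤ 1) (hd : ∀ e ∈ U, (d e).card = r)
    {G : Finset E} (hG : G ⊆ U) : 0 ≤ mixWeight U d q η G := by
  refine mul_nonneg (by positivity) (Finset.sum_nonneg fun z _ => mul_nonneg
    (Finset.prod_nonneg fun e he => ?_) (Finset.prod_nonneg fun e he => ?_))
  · exact (edgeProb_mem_Icc hq hη hr hqr (hd e (hG he)) z).1
  · exact sub_nonneg.2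
      (edgeProb_mem_Icc hq hη hr hqr (hd e (Finset.sdiff_subset he)) z).2

theorem sum_mixWeight_superset {E ι : Type*} [DecidableEq E] [Fintype ι] [DecidableEq ι]
    {U C : Finset E} (hC : C ⊆ U) (d : E → Finset ι) (q η : ℝ) :
    ∑ G ∈ U.powerset with C ⊆ G, mixWeight U d q η G =
      (Fintype.card (ι → ℤˣ) : ℝ)⁻¹ * ∑ z, ∏ e ∈ C, edgeProb d q η z e := by
  simp only [mixWeight]
  rw [← Finset.mul_sum, Finset.sum_comm]
  simp only [sum_bernoulliWeight_superset hC]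

theorem sum_mixWeight {E ι : Type*} [DecidableEq E] [Fintype ι] [DecidableEq ι]
    (U : Finset E) (d : E → Finset ι) (q η : ℝ) :
    ∑ G ∈ U.powerset, mixWeight U d q η G = 1 := by
  have h := sum_mixWeight_superset (Finset.empty_subset U) d q η
  simpa using h

/-- The probability that the random set contains a prescribed sequence of `n` distinct elements,
when the elements with indices `2k` and `2k + 1` depend on a common sign. -/
theorem pow_mul_pow_le_sum_mixWeight {E ι : Type*} [DecidableEq E] [Fintype ι] [DecidableEq ι]
    {U : Finset E} (d : E → Finset ι) {q η : ℝ} (hq : 0 ≤ q) (hη : 0 ≤ η) (n : ℕ) (w : ℕ → E)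
    (hwU : ∀ i < n, w i ∈ U) (hinj : Set.InjOn w (Finset.range n))
    (hw : ∀ k, 2 * k + 1 < n → ∃ s, s ∈ d (w (2 * k)) ∧ s ∈ d (w (2 * k + 1))) :
    q ^ n * (1 + η ^ 2) ^ (n / 2) ≤
      ∑ G ∈ U.powerset with (Finset.range n).image w ⊆ G, mixWeight U d q η G := by
  rw [sum_mixWeight_superset (Finset.image_subset_iff.2 fun i hi => hwU i (Finset.mem_range.1 hi))]
  have h := card_mul_pow_le_sum_prod hη (fun i => d (w i)) n hw
  have hcard : (0 : ℝ) < Fintype.card (ι → ℤˣ) := by exact_mod_cast Fintype.card_pos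
  rw [inv_mul_eq_div, le_div_iff₀ hcard]
  have h2 : ∀ z : ι → ℤˣ, ∏ e ∈ (Finset.range n).image w, edgeProb d q η z e =
      q ^ n * ∏ i ∈ Finset.range n, (1 + η * ∑ s ∈ d (w i), sgn s z) := by
    intro z
    rw [Finset.prod_image hinj]
    simp [edgeProb, Finset.prod_mul_distrib]
  simp only [h2]
  rw [← Finset.mul_sum]
  calc _ = q ^ n * ((Fintype.card (ι → ℤˣ) : ℝ) * (1 + η ^ 2) ^ (n / 2)) := by ring
    _ ≤ _ := mul_le_mul_of_nonneg_left h (pow_nonneg hq n)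

/-! ### Concentration -/

theorem sum_exp_sum_sgn_le {ι : Type*} [Fintype ι] [DecidableEq ι] (c : ι → ℝ) :
    ∑ z : ι → ℤˣ, Real.exp (∑ s, c s * sgn s z) ≤
      (Fintype.card (ι → ℤˣ) : ℝ) * Real.exp (∑ s, c s ^ 2 / 2) := by
  have h := Fintype.prod_sum (fun (s : ι) (u : ℤˣ) => Real.exp (c s * ((u : ℤ) : ℝ)))
  simp only [Real.exp_sum, sgn]
  rw [← h, card_signs, ← Finset.prod_mul_distrib]
  refine Finset.prod_le_prod (fun s _ => Finset.sum_nonneg fun u _ => (Real.exp_pos _).le)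
    fun s _ => ?_
  have h2 := Real.cosh_le_exp_half_sq (c s)
  rw [Real.cosh_eq] at h2
  rw [sum_units]
  simp only [Units.val_one, Int.cast_one, mul_one, Units.val_neg, Int.cast_neg, mul_neg]
  linarith

/-- The exponential moment of the number of selected elements of `S`, when every sign influences at
most `D` elements. -/
theorem sum_mixWeight_mul_exp_le {E ι : Type*} [DecidableEq E] [Fintype ι] [DecidableEq ι]
    {U S : Finset E} (hS : S ⊆ U) {d : E → Finset ι} {q η : ℝ} {r D : ℕ} (hq : 0 ≤ q)
    (hη : 0 ≤ η) (hr : η * r ≤ 1) (hqr : q * (1 + η * r) ≤ 1) (hd : ∀ e ∈ U, (d e).card = r)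
    (hD : ∀ s, (S.filter fun e => s ∈ d e).card ≤ D) (l : ℝ) :
    ∑ G ∈ U.powerset, mixWeight U d q η G * Real.exp (l * (G ∩ S).card) ≤
      Real.exp ((Real.exp l - 1) * q * S.card
        + ((Real.exp l - 1) * q * η) ^ 2 * (D * r * S.card) / 2) := by
  set t := Real.exp l - 1 with ht
  set N : ι → ℕ := fun s => (S.filter fun e => s ∈ d e).card with hN
  have hcard : (0 : ℝ) < Fintype.card (ι → ℤˣ) := by exact_mod_cast Fintype.card_pos
  have hsum : ∑ s, N s = r * S.card := by
    have := Finset.sum_card_bipartiteAbove_eq_sum_card_bipartiteBelow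
      (fun (e : E) (s : ι) => s ∈ d e) (s := S) (t := Finset.univ)
    simp only [Finset.bipartiteAbove, Finset.bipartiteBelow, Finset.filter_univ_mem] at this
    rw [hN, ← this, Finset.sum_congr rfl fun e he => hd e (hS he)]
    simp [mul_comm]
  have hz : ∀ z : ι → ℤˣ, ∑ G ∈ U.powerset, bernoulliWeight U (edgeProb d q η z) G *
      Real.exp (l * (G ∩ S).card) ≤
      Real.exp (t * q * S.card) * Real.exp (∑ s, (t * q * η * N s) * sgn s z) := by
    intro z
    have h1 : ∀ G : Finset E, Real.exp (l * (G ∩ S).card) = Real.exp l ^ (G ∩ S).card := by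
      intro G
      rw [← Real.exp_nat_mul, mul_comm]
    simp only [h1]
    rw [sum_bernoulliWeight_mul_pow hS]
    have h2 : ∑ s, (N s : ℝ) * sgn s z = ∑ e ∈ S, ∑ s ∈ d e, sgn s z := by
      rw [Finset.sum_comm' (t' := Finset.univ) (s' := fun s => S.filter fun e => s ∈ d e)]
      · simp [hN]
      · simp
    calc ∏ e ∈ S, (1 + edgeProb d q η z e * t)
        ≤ ∏ e ∈ S, Real.exp (edgeProb d q η z e * t) := by
          refine Finset.prod_le_prod (fun e he => ?_) fun e _ => ?_
          · have := edgeProb_mem_Icc hq hη hr hqr (hd e (hS he)) z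
            have h3 : edgeProb d q η z e * t =
              edgeProb d q η z e * Real.exp l - edgeProb d q η z e := by rw [ht]; ring
            have := mul_nonneg this.1 (Real.exp_pos l).le
            linarith [(edgeProb_mem_Icc hq hη hr hqr (hd e (hS he)) z).2]
          · rw [add_comm]
            exact Real.add_one_le_exp _
      _ = Real.exp (t * q * S.card) * Real.exp (∑ s, (t * q * η * N s) * sgn s z) := by
          rw [← Real.exp_sum, ← Real.exp_add]
          congr 1
          simp only [edgeProb, mul_assoc]
          simp only [← Finset.mul_sum, ← Finset.sum_mul, h2, mul_add, add_mul,
            Finset.sum_add_distrib]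
          simp only [Finset.sum_const, nsmul_eq_mul]
          ring
  calc ∑ G ∈ U.powerset, mixWeight U d q η G * Real.exp (l * (G ∩ S).card)
      = (Fintype.card (ι → ℤˣ) : ℝ)⁻¹ * ∑ z, ∑ G ∈ U.powerset,
          bernoulliWeight U (edgeProb d q η z) G * Real.exp (l * (G ∩ S).card) := by
        simp only [mixWeight, mul_assoc, ← Finset.mul_sum]
        rw [Finset.sum_comm]
        simp only [Finset.sum_mul]
    _ ≤ (Fintype.card (ι → ℤˣ) : ℝ)⁻¹ * (Real.exp (t * q * S.card) *
          ((Fintype.card (ι → ℤˣ) : ℝ) * Real.exp (∑ s, (t * q * η * N s) ^ 2 / 2))) := by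
        gcongr
        refine (Finset.sum_le_sum fun z _ => hz z).trans ?_
        rw [← Finset.mul_sum]
        gcongr
        exact sum_exp_sum_sgn_le _
    _ = Real.exp (t * q * S.card + ∑ s, (t * q * η * N s) ^ 2 / 2) := by
        rw [Real.exp_add]
        field_simp
    _ ≤ _ := by
        gcongr
        have h4 : ∑ s, (t * q * η * N s) ^ 2 / 2 = (t * q * η) ^ 2 / 2 * ∑ s, (N s : ℝ) ^ 2 := by
          rw [Finset.mul_sum]
          exact Finset.sum_congr rfl fun s _ => by ring
        have h5 : ∑ s, (N s : ℝ) ^ 2 ≤ D * (r * S.card) := by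
          calc ∑ s, (N s : ℝ) ^ 2 ≤ ∑ s, (D : ℝ) * N s := by
                refine Finset.sum_le_sum fun s _ => ?_
                rw [sq]
                gcongr
                exact_mod_cast hD s
            _ = D * (r * S.card) := by
                rw [← Finset.mul_sum]
                congr 1
                exact_mod_cast hsum
        rw [h4]
        calc _ ≤ (t * q * η) ^ 2 / 2 * (D * (r * S.card)) := by gcongr
          _ = _ := by ring

/-- One-sided concentration; `σ = 1` is the upper and `σ = -1` the lower tail. -/
theorem sum_mixWeight_tail_le {E ι : Type*} [DecidableEq E] [Fintype ι] [DecidableEq ι]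
    {U S : Finset E} (hS : S ⊆ U) {d : E → Finset ι} {q η κ : ℝ} {r D : ℕ} (hq : 0 ≤ q)
    (hq1 : q ≤ 1) (hη : 0 ≤ η) (hr : η * r ≤ 1) (hqr : q * (1 + η * r) ≤ 1) (hr1 : 1 ≤ r)
    (hD1 : 1 ≤ D) (hd : ∀ e ∈ U, (d e).card = r)
    (hD : ∀ s, (S.filter fun e => s ∈ d e).card ≤ D) (hκ : 0 < κ) (hκ1 : κ ≤ 1)
    {σ : ℝ} (hσ : |σ| = 1) :
    ∑ G ∈ U.powerset with κ * S.card ≤ σ * ((G ∩ S).card - q * S.card),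
      mixWeight U d q η G ≤ Real.exp (-(κ ^ 2 * S.card / (12 * D * r))) := by
  have hr1' : (1 : ℝ) ≤ r := by exact_mod_cast hr1
  have hD1' : (1 : ℝ) ≤ D := by exact_mod_cast hD1
  have hDr : (1 : ℝ) ≤ D * r := by nlinarith
  set a : ℝ := κ / (6 * (D * r)) with ha
  have ha0 : 0 < a := by positivity
  have ha1 : a ≤ 1 := by
    rw [ha, div_le_one (by positivity)]
    linarith
  have hσ2 : σ ^ 2 = 1 := by rw [← sq_abs, hσ, one_pow]
  set l : ℝ := σ * a with hl
  have hla : |l| = a := by rw [hl, abs_mul, hσ, one_mul, abs_of_pos ha0]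
  have hl2 : l ^ 2 = a ^ 2 := by rw [hl, mul_pow, hσ2, one_mul]
  have h1 := sum_mixWeight_mul_exp_le hS hq hη hr hqr hd hD l
  have hη1 : η ≤ 1 := by nlinarith
  have ht1 := (abs_le.1 (Real.abs_exp_sub_one_sub_id_le (x := l) (by rw [hla]; exact ha1))).2
  have ht2 := Real.abs_exp_sub_one_le (x := l) (by rw [hla]; exact ha1)
  set t := Real.exp l - 1 with ht
  set n : ℝ := (S.card : ℝ) with hn
  have hn0 : 0 ≤ n := by positivity
  have ht3 : (t * q * η) ^ 2 ≤ 4 * a ^ 2 := by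
    have hqη : |q * η| ≤ 1 := by
      rw [abs_of_nonneg (mul_nonneg hq hη)]
      exact mul_le_one₀ hq1 hη hη1
    have : |t * q * η| ≤ 2 * a := by
      rw [mul_assoc, abs_mul]
      calc |t| * |q * η| ≤ |t| * 1 := by gcongr
        _ ≤ 2 * a := by rw [mul_one, ← hla]; exact ht2
    calc (t * q * η) ^ 2 = |t * q * η| ^ 2 := (sq_abs _).symm
      _ ≤ (2 * a) ^ 2 := by gcongr
      _ = 4 * a ^ 2 := by ring
  have hexp : t * q * n + (t * q * η) ^ 2 * (D * r * n) / 2 - a * κ * n - l * (q * n) ≤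
      -(κ ^ 2 * n / (12 * D * r)) := by
    have e1 : t * q * n ≤ (l + a ^ 2) * q * n := by
      gcongr
      rw [← hl2]
      linarith
    have e2 : a ^ 2 * q * n ≤ a ^ 2 * (D * r) * n := by
      gcongr
      linarith
    have e3 : (t * q * η) ^ 2 * (D * r * n) / 2 ≤ 4 * a ^ 2 * (D * r * n) / 2 := by gcongr
    have e4 : 3 * (a ^ 2 * (D * r) * n) - a * κ * n = -(κ ^ 2 * n / (12 * D * r)) := by
      rw [ha]
      field_simp
      ring
    nlinarith
  calc ∑ G ∈ U.powerset with κ * n ≤ σ * ((G ∩ S).card - q * n), mixWeight U d q η G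
      ≤ ∑ G ∈ U.powerset, mixWeight U d q η G * Real.exp (l * (G ∩ S).card) *
          Real.exp (- a * κ * n - l * (q * n)) := by
        rw [Finset.sum_filter]
        refine Finset.sum_le_sum fun G hG => ?_
        have hw := mixWeight_nonneg hq hη hr hqr hd (Finset.mem_powerset.1 hG)
        split_ifs with hG'
        · rw [mul_assoc, ← Real.exp_add]
          refine le_mul_of_one_le_right hw (Real.one_le_exp ?_)
          have := mul_le_mul_of_nonneg_left hG' ha0.le
          rw [hl]
          linarith
        · positivity
    _ ≤ Real.exp (t * q * n + (t * q * η) ^ 2 * (D * r * n) / 2) *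
          Real.exp (- a * κ * n - l * (q * n)) := by
        rw [← Finset.sum_mul]
        gcongr
    _ ≤ _ := by
        rw [← Real.exp_add]
        gcongr
        linarith

end SignModel

/-! ### Windows of a cyclic ordering -/

namespace RGraph

/-- The position `k` taken modulo `n`. -/
def pos {n : ℕ} (i : Fin n) (k : ℕ) : Fin n := ⟨k % n, Nat.mod_lt _ i.pos⟩

theorem pos_of_lt {n : ℕ} (i : Fin n) {k : ℕ} (hk : k < n) : pos i k = ⟨k, hk⟩ :=
  Fin.ext (Nat.mod_eq_of_lt hk)

theorem pos_cases {n : ℕ} (i j : Fin n) {a : ℕ} (ha : a ≤ n) :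
    (i.val + a < n ∧ (pos j (i.val + a)).val = i.val + a) ∨
      (n ≤ i.val + a ∧ (pos j (i.val + a)).val + n = i.val + a) := by
  rcases lt_or_ge (i.val + a) n with h | h
  · exact Or.inl ⟨h, Nat.mod_eq_of_lt h⟩
  · refine Or.inr ⟨h, ?_⟩
    have h2 : (pos j (i.val + a)).val = i.val + a - n := by
      change (i.val + a) % n = _
      rw [Nat.mod_eq_sub_mod h, Nat.mod_eq_of_lt (by have := i.isLt; omega)]
    omega

theorem mem_window {r n : ℕ} {π : Equiv.Perm (Fin n)} {i x : Fin n} :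
    x ∈ window r π i ↔ ∃ a < r, π (pos i (i.val + a)) = x := by
  simp [window, pos]

theorem pos_add_injective {n : ℕ} (i : Fin n) {a b : ℕ} (ha : a < n) (hb : b < n)
    (h : pos i (i.val + a) = pos i (i.val + b)) : a = b := by
  have h' := congrArg Fin.val h
  have := pos_cases i i ha.le
  have := pos_cases i i hb.le
  omega

theorem card_window {r n : ℕ} (hn : r ≤ n) (π : Equiv.Perm (Fin n)) (i : Fin n) :
    (window r π i).card = r := by
  rw [window, Finset.card_image_of_injOn, Finset.card_range]
  intro a ha b hb h
  have ha' := Finset.mem_range.1 ha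
  have hb' := Finset.mem_range.1 hb
  exact pos_add_injective i (by omega) (by omega) (π.injective h)

/-- The only windows that contain the `r - 1` vertices following the one at position `i` are those
starting at `i` and at `i + 1`. -/
theorem eq_or_eq_of_mem_window {r n : ℕ} (hr : 2 ≤ r) (hn : 2 * r ≤ n) {π : Equiv.Perm (Fin n)}
    {i j : Fin n} (h1 : π (pos i (i.val + 1)) ∈ window r π j)
    (h2 : π (pos i (i.val + (r - 1))) ∈ window r π j) :
    j = i ∨ j = pos i (i.val + 1) := by
  obtain ⟨s, hs, h1⟩ := mem_window.1 h1
  obtain ⟨t, ht, h2⟩ := mem_window.1 h2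
  have h1 := congrArg Fin.val (π.injective h1)
  have h2 := congrArg Fin.val (π.injective h2)
  have c1 := pos_cases i i (a := 1) (by omega)
  have c2 := pos_cases i i (a := r - 1) (by omega)
  have c3 := pos_cases j j (a := s) (by omega)
  have c4 := pos_cases j j (a := t) (by omega)
  have := i.isLt
  have := j.isLt
  rw [Fin.ext_iff, Fin.ext_iff]
  omega

theorem window_injective {r n : ℕ} (hr : 2 ≤ r) (hn : 2 * r ≤ n) (π : Equiv.Perm (Fin n)) :
    Function.Injective (window r π) := by
  intro i j h
  have hmem : ∀ (i : Fin n) a, a < r → π (pos i (i.val + a)) ∈ window r π i :=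
    fun i a ha => mem_window.2 ⟨a, ha, rfl⟩
  have c1 := eq_or_eq_of_mem_window hr hn (i := i) (j := j)
    (h ▸ hmem i 1 (by omega)) (h ▸ hmem i (r - 1) (by omega))
  have c2 := eq_or_eq_of_mem_window hr hn (i := j) (j := i)
    (h ▸ hmem j 1 (by omega)) (h ▸ hmem j (r - 1) (by omega))
  have d1 := pos_cases i i (a := 1) (by omega)
  have d2 := pos_cases j j (a := 1) (by omega)
  simp only [Fin.ext_iff] at c1 c2 ⊢
  omega

/-- An ordering is determined by its Hamiltonian cycle and its first `r` vertices: after that, each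
next vertex is the one that completes the last `r - 1` vertices to a new edge of the cycle. -/
theorem eq_of_rSet_eq {r n : ℕ} (hr : 2 ≤ r) (hn : 2 * r ≤ n) {π σ : Equiv.Perm (Fin n)}
    (hset : rSet r π = rSet r σ) (hinit : ∀ k : Fin n, k.val < r → π k = σ k) : π = σ := by
  have key : ∀ k (hk : k < n), π ⟨k, hk⟩ = σ ⟨k, hk⟩ := by
    intro k
    induction k using Nat.strong_induction_on with
    | _ k ih =>
      intro hk
      rcases lt_or_ge k r with hkr | hkr
      · exact hinit _ hkr
      obtain ⟨i, rfl⟩ := Nat.exists_eq_add_of_le' hkr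
      have hi : i < n := by omega
      have hi1 : i + 1 < n := by omega
      have hmem : ∀ (τ : Equiv.Perm (Fin n)) (a : ℕ) (ha : a < r),
          τ ⟨i + 1 + a, by omega⟩ ∈ window r τ ⟨i + 1, hi1⟩ := fun τ a ha =>
        mem_window.2 ⟨a, ha, congrArg τ (pos_of_lt _ _)⟩
      have hw : window r π ⟨i + 1, hi1⟩ ∈ rSet r σ := by
        rw [← hset]
        exact Finset.mem_image_of_mem _ (Finset.mem_univ _)
      obtain ⟨j, -, hj⟩ := Finset.mem_image.1 hw
      have hs : ∀ (a : ℕ) (ha : a + 1 < r), σ ⟨i + 1 + a, by omega⟩ ∈ window r σ j := by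
        intro a ha
        rw [hj, ← ih (i + 1 + a) (by omega) (by omega)]
        exact hmem π a (by omega)
      have hcases := eq_or_eq_of_mem_window hr hn (π := σ) (i := ⟨i, hi⟩) (j := j)
        (by
          rw [pos_of_lt _ (k := i + 1) (by omega)]
          exact hs 0 (by omega))
        (by
          rw [pos_of_lt _ (k := i + (r - 1)) (by omega)]
          convert hs (r - 2) (by omega) using 3
          omega)
      rcases hcases with rfl | rfl
      · -- The window of `σ` at `i` agrees with that of `π`, whose windows are distinct.
        exfalso
        have hii : window r σ ⟨i, hi⟩ = window r π ⟨i, hi⟩ := by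
          rw [window, window]
          refine Finset.image_congr fun a ha => ?_
          have ha' := Finset.mem_range.1 ha
          change σ (pos ⟨i, hi⟩ (i + a)) = π (pos ⟨i, hi⟩ (i + a))
          rw [pos_of_lt _ (show i + a < n by omega), ih (i + a) (by omega) (by omega)]
        have := window_injective hr hn π (hii ▸ hj)
        rw [Fin.ext_iff] at this
        simp at this
      · rw [pos_of_lt _ hi1] at hj
        have h := hmem π (r - 1) (by omega)
        rw [← hj] at h
        obtain ⟨a, ha, hπ⟩ := mem_window.1 h
        have e1 : i + 1 + (r - 1) = i + r := by omega
        simp only [e1] at hπ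
        rw [pos_of_lt _ (k := i + 1 + a) (by omega)] at hπ
        rcases Nat.lt_or_ge (a + 1) r with har | har
        · rw [← ih (i + 1 + a) (by omega) (by omega)] at hπ
          have := Fin.ext_iff.1 (π.injective hπ)
          simp only at this
          omega
        · rw [← hπ]
          congr 2
          omega
  exact Equiv.ext fun k => key k.val k.isLt

/-- A Hamiltonian cycle comes from at most `n ^ r` orderings. -/
theorem card_perm_le_hamCount_mul {r n : ℕ} (hr : 2 ≤ r) (hn : 2 * r ≤ n) (G : RGraph r n) :
    (Finset.univ.filter fun π : Equiv.Perm (Fin n) => rSet r π ⊆ G.edges).card ≤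
      G.hamCount * n ^ r := by
  have hcard : (G.hamCycles ×ˢ (Finset.univ : Finset (Fin r → Fin n))).card =
      G.hamCount * n ^ r := by
    simp [Finset.card_product, hamCount]
  rw [← hcard]
  refine Finset.card_le_card_of_injOn
    (fun π => (rSet r π, fun a => π ⟨a.val, by have := a.isLt; omega⟩)) ?_ ?_
  · intro π hπ
    have hπ' := (Finset.mem_filter.1 hπ).2
    simpa [hamCycles] using hπ'
  · intro π _ σ _ h
    obtain ⟨h1, h2⟩ := Prod.mk.inj h
    exact eq_of_rSet_eq hr hn h1 fun k hk => congrFun h2 ⟨k.val, hk⟩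

/-- Consecutive windows have `r - 1` common vertices. -/
theorem exists_common_powersetCard {r n : ℕ} (hr : 1 ≤ r) (hn : r ≤ n)
    (π : Equiv.Perm (Fin n)) {i : ℕ} (hi : i + 1 < n) :
    ∃ s, s ∈ (window r π ⟨i, by omega⟩).powersetCard (r - 1) ∧
      s ∈ (window r π ⟨i + 1, hi⟩).powersetCard (r - 1) := by
  refine ⟨window (r - 1) π ⟨i + 1, hi⟩, ?_, ?_⟩ <;>
    refine Finset.mem_powersetCard.2 ⟨fun x hx => ?_, card_window (by omega) π _⟩ <;>
    obtain ⟨a, ha, rfl⟩ := mem_window.1 hx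
  · exact mem_window.2 ⟨a + 1, by omega, congrArg π (Fin.ext (by simp [pos]; congr 1; omega))⟩
  · exact mem_window.2 ⟨a, by omega, rfl⟩

end RGraph

/-! ### A quasi-random graph with many Hamiltonian cycles -/

namespace RGraph

open SignModel

theorem card_filter_mem_powersetCard_le {r n : ℕ} (hr : 1 ≤ r) {S : Finset (Finset (Fin n))}
    (hS : S ⊆ Finset.univ.powersetCard r) (s : Finset (Fin n)) :
    (S.filter fun e => s ∈ e.powersetCard (r - 1)).card ≤ n := by
  have hsub : (S.filter fun e => s ∈ e.powersetCard (r - 1)) ⊆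
      Finset.univ.image fun v => insert v s := by
    intro e he
    obtain ⟨he, hs⟩ := Finset.mem_filter.1 he
    have hcard := (Finset.mem_powersetCard.1 (hS he)).2
    obtain ⟨hse, hscard⟩ := Finset.mem_powersetCard.1 hs
    obtain ⟨a, -, ha⟩ := Finset.exists_eq_insert_iff.2 ⟨hse, by omega⟩
    exact Finset.mem_image.2 ⟨a, Finset.mem_univ _, ha⟩
  refine (Finset.card_le_card hsub).trans (Finset.card_image_le.trans ?_)
  simp

theorem inter_powersetCard_eq_filter {r n : ℕ} {G : Finset (Finset (Fin n))}
    (hG : G ⊆ Finset.univ.powersetCard r) (W : Finset (Fin n)) :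
    G ∩ W.powersetCard r = G.filter (· ⊆ W) := by
  ext e
  simp only [Finset.mem_inter, Finset.mem_filter, Finset.mem_powersetCard]
  exact ⟨fun h => ⟨h.1, h.2.1⟩,
    fun h => ⟨h.1, h.2, (Finset.mem_powersetCard.1 (hG h.1)).2⟩⟩

/-- `G` has edge density within `κ` of `q` on every set of at least half of the vertices. -/
def IsUniform {n : ℕ} (r : ℕ) (q κ : ℝ) (G : Finset (Finset (Fin n))) : Prop :=
  ∀ W : Finset (Fin n), n / 2 ≤ W.card →
    |((G.filter (· ⊆ W)).card : ℝ) - q * (W.card.choose r : ℝ)| < κ * (W.card.choose r : ℝ)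

open scoped Classical in
/-- The probability that the random graph is not uniform, by a union bound over the vertex sets and
the two tails. -/
theorem sum_mixWeight_not_isUniform_le {r n : ℕ} {q η κ : ℝ} (hr1 : 1 ≤ r) (hn : 1 ≤ n)
    (hq : 0 ≤ q) (hq1 : q ≤ 1) (hη : 0 ≤ η) (hr : η * r ≤ 1) (hqr : q * (1 + η * r) ≤ 1)
    (hκ : 0 < κ) (hκ1 : κ ≤ 1) :
    ∑ G ∈ ((Finset.univ : Finset (Fin n)).powersetCard r).powerset with ¬ IsUniform r q κ G,
      mixWeight (Finset.univ.powersetCard r) (fun e => e.powersetCard (r - 1)) q η G ≤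
      2 ^ n * (2 * Real.exp (-(κ ^ 2 * ((n / 2).choose r : ℝ) / (12 * n * r)))) := by
  set U := (Finset.univ : Finset (Fin n)).powersetCard r with hU
  set d : Finset (Fin n) → Finset (Finset (Fin n)) := fun e => e.powersetCard (r - 1) with hd
  set M := mixWeight U d q η with hM
  have hdU : ∀ e ∈ U, (d e).card = r := by
    intro e he
    rw [hd, Finset.card_powersetCard, (Finset.mem_powersetCard.1 he).2,
      Nat.choose_symm hr1, Nat.choose_one_right]
  have hM0 : ∀ G ∈ U.powerset, 0 ≤ M G := fun G hG =>
    mixWeight_nonneg hq hη hr hqr hdU (Finset.mem_powerset.1 hG)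
  set T : Finset (Fin n) → ℝ → Finset (Finset (Fin n)) → Prop := fun W σ G =>
    κ * (W.powersetCard r).card ≤
      σ * ((G ∩ W.powersetCard r).card - q * (W.powersetCard r).card) with hT
  set 𝒲 : Finset (Finset (Fin n)) := Finset.univ.filter fun W => n / 2 ≤ W.card with h𝒲
  set B := Real.exp (-(κ ^ 2 * ((n / 2).choose r : ℝ) / (12 * n * r))) with hB
  have htail : ∀ W ∈ 𝒲, ∀ σ : ℝ, |σ| = 1 → ∑ G ∈ U.powerset with T W σ G, M G ≤ B := by
    intro W hW σ hσ
    have hWU : W.powersetCard r ⊆ U := Finset.powersetCard_mono (Finset.subset_univ _)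
    refine (sum_mixWeight_tail_le hWU hq hq1 hη hr hqr hr1 hn hdU
      (fun s => card_filter_mem_powersetCard_le hr1 hWU s) hκ hκ1 hσ).trans ?_
    rw [hB, Finset.card_powersetCard]
    have := Nat.choose_le_choose r (Finset.mem_filter.1 hW).2
    gcongr
  have hpoint : ∀ G ∈ U.powerset, (if ¬ IsUniform r q κ G then M G else 0) ≤
      ∑ W ∈ 𝒲, ((if T W 1 G then M G else 0) + if T W (-1) G then M G else 0) := by
    intro G hG
    have h0 : ∀ W σ, 0 ≤ if T W σ G then M G else 0 := by
      intro W σ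
      split_ifs
      exacts [hM0 G hG, le_rfl]
    split_ifs with hbad
    · exact Finset.sum_nonneg fun W _ => add_nonneg (h0 W 1) (h0 W (-1))
    · rw [IsUniform] at hbad
      push Not at hbad
      obtain ⟨W, hW, hle⟩ := hbad
      refine le_trans ?_ (Finset.single_le_sum
        (fun W _ => add_nonneg (h0 W 1) (h0 W (-1)))
        (Finset.mem_filter.2 ⟨Finset.mem_univ W, hW⟩))
      rw [← inter_powersetCard_eq_filter (Finset.mem_powerset.1 hG),
        ← Finset.card_powersetCard] at hle
      rcases le_abs.1 hle with h | h
      · have hT1 : T W 1 G := by rw [hT]; linarith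
        rw [if_pos hT1]
        exact le_add_of_nonneg_right (h0 W (-1))
      · have hT1 : T W (-1) G := by rw [hT]; linarith
        rw [if_pos hT1]
        exact le_add_of_nonneg_left (h0 W 1)
  rw [Finset.sum_filter]
  refine (Finset.sum_le_sum hpoint).trans ?_
  rw [Finset.sum_comm]
  calc _ ≤ ∑ W ∈ 𝒲, 2 * B := by
        refine Finset.sum_le_sum fun W hW => ?_
        rw [Finset.sum_add_distrib, ← Finset.sum_filter, ← Finset.sum_filter]
        linarith [htail W hW 1 (by simp), htail W hW (-1) (by simp)]
    _ = (𝒲.card : ℝ) * (2 * B) := by simp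
    _ ≤ 2 ^ n * (2 * B) := by
        have h : 𝒲.card ≤ 2 ^ n := (Finset.card_le_univ _).trans (by simp)
        have hB0 : 0 ≤ 2 * B := by positivity
        gcongr
        exact_mod_cast h

/-- First moment: the expected number of orderings whose cycle lies in the random graph. -/
theorem le_sum_mixWeight_mul_card {r n : ℕ} {q η : ℝ} (hr : 2 ≤ r) (hn : 2 * r ≤ n)
    (hq : 0 ≤ q) (hη : 0 ≤ η) :
    (n.factorial : ℝ) * (q ^ n * (1 + η ^ 2) ^ (n / 2)) ≤
      ∑ G ∈ ((Finset.univ : Finset (Fin n)).powersetCard r).powerset,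
        mixWeight (Finset.univ.powersetCard r) (fun e => e.powersetCard (r - 1)) q η G *
          ((Finset.univ.filter fun π : Equiv.Perm (Fin n) => rSet r π ⊆ G).card : ℝ) := by
  set U := (Finset.univ : Finset (Fin n)).powersetCard r with hU
  set d : Finset (Fin n) → Finset (Finset (Fin n)) := fun e => e.powersetCard (r - 1) with hd
  have hn0 : 0 < n := by omega
  have hπ : ∀ π : Equiv.Perm (Fin n), q ^ n * (1 + η ^ 2) ^ (n / 2) ≤
      ∑ G ∈ U.powerset with rSet r π ⊆ G, mixWeight U d q η G := by
    intro π
    set w : ℕ → Finset (Fin n) := fun i => window r π (pos ⟨0, hn0⟩ i) with hw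
    have hwlt : ∀ i (hi : i < n), w i = window r π ⟨i, hi⟩ := fun i hi => by
      rw [hw]
      simp only [pos_of_lt _ hi]
    have himg : (Finset.range n).image w = rSet r π := by
      ext e
      simp only [Finset.mem_image, Finset.mem_range, rSet, Finset.mem_univ, true_and]
      constructor
      · rintro ⟨i, hi, rfl⟩
        exact ⟨⟨i, hi⟩, (hwlt i hi).symm⟩
      · rintro ⟨i, rfl⟩
        exact ⟨i.val, i.isLt, hwlt i.val i.isLt⟩
    rw [← himg]
    refine pow_mul_pow_le_sum_mixWeight d hq hη n w ?_ ?_ ?_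
    · intro i _
      exact Finset.mem_powersetCard.2 ⟨Finset.subset_univ _, card_window (by omega) π _⟩
    · intro i hi j hj h
      have hi := Finset.mem_range.1 hi
      have hj := Finset.mem_range.1 hj
      rw [hwlt i hi, hwlt j hj] at h
      exact Fin.ext_iff.1 (window_injective hr hn π h)
    · intro k hk
      rw [hwlt (2 * k) (by omega), hwlt (2 * k + 1) hk]
      exact exists_common_powersetCard (by omega) (by omega) π hk
  have hcard : (n.factorial : ℝ) = ∑ _π : Equiv.Perm (Fin n), (1 : ℝ) := by
    simp [Fintype.card_perm]
  rw [hcard, Finset.sum_mul]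
  refine (Finset.sum_le_sum fun π _ => (one_mul _).le.trans (hπ π)).trans ?_
  simp only [Finset.sum_filter]
  rw [Finset.sum_comm]
  refine Finset.sum_le_sum fun G _ => ?_
  rw [← Finset.sum_filter, Finset.sum_const, nsmul_eq_mul, mul_comm]

/-- Some uniform graph contains the cycles of at least half of the expected number of orderings:
the nonuniform graphs are too unlikely to contribute, even if they contained all `n!` of them. -/
theorem exists_isUniform {r n : ℕ} {q η κ : ℝ} (hr2 : 2 ≤ r) (hn : 2 * r ≤ n)
    (hq : 0 < q) (hq1 : q ≤ 1) (hη : 0 ≤ η) (hr : η * r ≤ 1) (hqr : q * (1 + η * r) ≤ 1)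
    (hκ : 0 < κ) (hκ1 : κ ≤ 1)
    (hbad : 2 ^ n * (2 * Real.exp (-(κ ^ 2 * ((n / 2).choose r : ℝ) / (12 * n * r)))) ≤
      q ^ n / 4) :
    ∃ G ⊆ (Finset.univ : Finset (Fin n)).powersetCard r, IsUniform r q κ G ∧
      (n.factorial : ℝ) * (q ^ n * (1 + η ^ 2) ^ (n / 2)) / 2 ≤
        ((Finset.univ.filter fun π : Equiv.Perm (Fin n) => rSet r π ⊆ G).card : ℝ) := by
  classical
  set U := (Finset.univ : Finset (Fin n)).powersetCard r with hU
  set d : Finset (Fin n) → Finset (Finset (Fin n)) := fun e => e.powersetCard (r - 1) with hd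
  set M := mixWeight U d q η with hM
  set X : Finset (Finset (Fin n)) → ℝ := fun G =>
    ((Finset.univ.filter fun π : Equiv.Perm (Fin n) => rSet r π ⊆ G).card : ℝ) with hX
  set Y := (n.factorial : ℝ) * (q ^ n * (1 + η ^ 2) ^ (n / 2)) with hY
  by_contra! hcon
  have hdU : ∀ e ∈ U, (d e).card = r := by
    intro e he
    rw [hd, Finset.card_powersetCard, (Finset.mem_powersetCard.1 he).2,
      Nat.choose_symm (by omega), Nat.choose_one_right]
  have hfac : (0 : ℝ) < n.factorial := by exact_mod_cast n.factorial_pos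
  have hXle : ∀ G, X G ≤ n.factorial := by
    intro G
    have : (Finset.univ.filter fun π : Equiv.Perm (Fin n) => rSet r π ⊆ G).card ≤
        n.factorial := (Finset.card_le_univ _).trans (by simp [Fintype.card_perm])
    exact Nat.cast_le.2 this
  have hY0 : 0 < Y := by positivity
  have hlow : (n.factorial : ℝ) * q ^ n ≤ Y := by
    rw [hY]
    gcongr
    exact le_mul_of_one_le_right (by positivity) (one_le_pow₀ (by nlinarith))
  have hup : ∑ G ∈ U.powerset, M G * X G ≤ Y / 2 + n.factorial * (q ^ n / 4) := by
    calc ∑ G ∈ U.powerset, M G * X G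
        ≤ ∑ G ∈ U.powerset, (M G * (Y / 2) +
            n.factorial * if ¬ IsUniform r q κ G then M G else 0) := by
          refine Finset.sum_le_sum fun G hG => ?_
          have hM0 := mixWeight_nonneg hq.le hη hr hqr hdU (Finset.mem_powerset.1 hG)
          split_ifs with hu
          · have := mul_le_mul_of_nonneg_left (hcon G (Finset.mem_powerset.1 hG) hu).le hM0
            linarith
          · have := mul_le_mul_of_nonneg_left (hXle G) hM0
            have : 0 ≤ M G * (Y / 2) := by positivity
            linarith
      _ = Y / 2 + n.factorial * ∑ G ∈ U.powerset with ¬ IsUniform r q κ G, M G := by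
          rw [Finset.sum_add_distrib, ← Finset.sum_mul, sum_mixWeight, one_mul,
            ← Finset.mul_sum, Finset.sum_filter]
      _ ≤ _ := by
          gcongr
          exact (sum_mixWeight_not_isUniform_le (by omega) (by omega) hq.le hq1 hη hr hqr
            hκ hκ1).trans hbad
  have := le_sum_mixWeight_mul_card (q := q) (η := η) hr2 hn hq.le hη
  linarith

/-- A uniform graph of density about `q = p - 2κ` extends to a quasi-random graph of density
exactly `p`; the edges added are too few to affect any induced density by `ε`. -/
theorem exists_isQuasiRandom_of_isUniform {r n m : ℕ} {p ε κ K : ℝ} (hrn : r ≤ n / 2)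
    (hp1 : p ≤ 1) (hκ : 0 < κ) (hK : (n.choose r : ℝ) ≤ K * ((n / 2).choose r : ℝ))
    (hK1 : 1 ≤ K) (hκε : 3 * κ * K ≤ ε) (hm : (m : ℝ) = p * (n.choose r : ℝ))
    {G : Finset (Finset (Fin n))} (hGU : G ⊆ Finset.univ.powersetCard r)
    (hG : IsUniform r (p - 2 * κ) κ G) :
    ∃ H : RGraph r n, G ⊆ H.edges ∧ H.IsQuasiRandom ε p := by
  set N : ℝ := (n.choose r : ℝ) with hN
  have hN0 : 0 < N := by
    rw [hN]
    exact_mod_cast Nat.choose_pos (by omega)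
  have hGall := hG Finset.univ (by simp; omega)
  simp only [Finset.subset_univ, Finset.filter_true, Finset.card_univ, Fintype.card_fin]
    at hGall
  rw [← hN] at hGall
  obtain ⟨hG1, hG2⟩ := abs_lt.1 hGall
  have hGm : G.card ≤ m := by
    have : (G.card : ℝ) ≤ m := by
      rw [hm]
      nlinarith
    exact_mod_cast this
  have hmU : m ≤ ((Finset.univ : Finset (Fin n)).powersetCard r).card := by
    rw [Finset.card_powersetCard, Finset.card_univ, Fintype.card_fin]
    have : (m : ℝ) ≤ n.choose r := by
      rw [hm]
      exact mul_le_of_le_one_left hN0.le hp1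
    exact_mod_cast this
  obtain ⟨H, hGH, hHU, hHm⟩ := Finset.exists_subsuperset_card_eq hGU hGm hmU
  refine ⟨⟨H, fun e he => (Finset.mem_powersetCard.1 (hHU he)).2⟩, hGH, ?_, ?_⟩
  · change (H.card : ℝ) = p * N
    rw [hHm, hm]
  intro W hW
  obtain ⟨hW1, hW2⟩ := abs_lt.1 (hG W hW.ge)
  set NW : ℝ := (W.card.choose r : ℝ) with hNW
  have hNW0 : 0 < NW := by
    rw [hNW, hW]
    exact_mod_cast Nat.choose_pos hrn
  have hmono : ((G.filter (· ⊆ W)).card : ℝ) ≤ (H.filter (· ⊆ W)).card := by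
    exact_mod_cast Finset.card_le_card (Finset.filter_subset_filter _ hGH)
  have hadd : ((H.filter (· ⊆ W)).card : ℝ) ≤ (G.filter (· ⊆ W)).card + (m - G.card) := by
    have h1 : H.filter (· ⊆ W) ⊆ G.filter (· ⊆ W) ∪ H \ G := by
      intro e he
      rw [Finset.mem_filter] at he
      by_cases heG : e ∈ G
      · exact Finset.mem_union_left _ (Finset.mem_filter.2 ⟨heG, he.2⟩)
      · exact Finset.mem_union_right _ (Finset.mem_sdiff.2 ⟨he.1, heG⟩)
    have h2 := (Finset.card_le_card h1).trans (Finset.card_union_le _ _)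
    have h3 := Finset.card_sdiff_add_card_eq_card hGH
    rw [hHm] at h3
    have h2' : ((H.filter (· ⊆ W)).card : ℝ) ≤
        (G.filter (· ⊆ W)).card + (H \ G).card := by exact_mod_cast h2
    have h3' : ((H \ G).card : ℝ) + G.card = m := by exact_mod_cast h3
    linarith
  have hKN : N ≤ K * NW := by rw [hNW, hW]; exact hK
  have hmain : 3 * κ * N ≤ ε * NW := by
    calc 3 * κ * N ≤ 3 * κ * (K * NW) := by gcongr
      _ = 3 * κ * K * NW := by ring
      _ ≤ ε * NW := by gcongr
  have hε : 3 * κ ≤ ε := by nlinarith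
  change ((H.filter (· ⊆ W)).card : ℝ) / NW ∈ _
  constructor
  · rw [lt_div_iff₀ hNW0]
    nlinarith
  · rw [div_lt_iff₀ hNW0]
    nlinarith

theorem hamCount_le_maxHam {r n : ℕ} {p ε : ℝ} {G : RGraph r n} (hG : G.IsQuasiRandom ε p) :
    G.hamCount ≤ maxHam r n p ε :=
  le_csSup (bddAbove_hamCounts r n p ε) ⟨G, hG, rfl⟩

/-- The lower bound for the maximum in terms of the parameters of the sign model. -/
theorem le_maxHam_mul {r n m : ℕ} {p ε η κ K : ℝ} (hr2 : 2 ≤ r) (hn : 2 * r ≤ n)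
    (hq : 0 < p - 2 * κ) (hp1 : p ≤ 1) (hη : 0 ≤ η) (hr : η * r ≤ 1)
    (hqr : p * (1 + η * r) ≤ 1) (hκ : 0 < κ)
    (hbad : 2 ^ n * (2 * Real.exp (-(κ ^ 2 * ((n / 2).choose r : ℝ) / (12 * n * r)))) ≤
      (p - 2 * κ) ^ n / 4)
    (hK : (n.choose r : ℝ) ≤ K * ((n / 2).choose r : ℝ))
    (hK1 : 1 ≤ K) (hκε : 3 * κ * K ≤ ε) (hm : (m : ℝ) = p * (n.choose r : ℝ)) :
    (n.factorial : ℝ) * ((p - 2 * κ) ^ n * (1 + η ^ 2) ^ (n / 2)) / 2 ≤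
      (maxHam r n p ε : ℝ) * n ^ r := by
  have hηr : 0 ≤ η * r := by positivity
  obtain ⟨G, hGU, hGu, hG⟩ := exists_isUniform hr2 hn hq (by linarith) hη hr
    (by nlinarith) hκ (by linarith) hbad
  obtain ⟨H, hGH, hH⟩ := exists_isQuasiRandom_of_isUniform (by omega) hp1 hκ hK hK1 hκε hm hGU hGu
  have h1 := (Finset.card_le_card (Finset.monotone_filter_right Finset.univ
    (fun (π : Equiv.Perm (Fin n)) _ (h : rSet r π ⊆ G) => h.trans hGH))).trans
    (card_perm_le_hamCount_mul hr2 hn H)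
  have h2 := h1.trans (Nat.mul_le_mul_right (n ^ r) (hamCount_le_maxHam hH))
  exact hG.trans (by exact_mod_cast h2)

end RGraph

/-! ### Asymptotics -/

theorem choose_half_lower {r n : ℕ} (hn : 4 * r ≤ n) :
    ((n : ℝ) / 4) ^ r / (r.factorial : ℝ) ≤ ((n / 2).choose r : ℝ) := by
  refine le_trans ?_ (Nat.pow_le_choose r (n / 2))
  gcongr
  rw [div_le_iff₀ (by norm_num)]
  have : n ≤ (n / 2 + 1 - r) * 4 := by omega
  exact_mod_cast this

theorem choose_le_four_pow_mul_choose_half {r n : ℕ} (hn : 4 * r ≤ n) :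
    (n.choose r : ℝ) ≤ 4 ^ r * ((n / 2).choose r : ℝ) := by
  calc (n.choose r : ℝ) ≤ (n : ℝ) ^ r / r.factorial := Nat.choose_le_pow_div r n
    _ = 4 ^ r * (((n : ℝ) / 4) ^ r / r.factorial) := by
        rw [div_pow]
        field_simp
    _ ≤ _ := by
        gcongr
        exact choose_half_lower hn

/-- Here `3 ≤ r` is needed: the concentration is of order `exp (-c * n ^ (r - 1))`, which has to
beat the number `2 ^ n` of vertex sets. -/
theorem eventually_two_pow_mul_exp_le {r : ℕ} (hr : 3 ≤ r) {q κ : ℝ} (hq : 0 < q) (hκ : 0 < κ) :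
    ∀ᶠ n : ℕ in atTop,
      2 ^ n * (2 * Real.exp (-(κ ^ 2 * ((n / 2).choose r : ℝ) / (12 * n * r)))) ≤ q ^ n / 4 := by
  set c : ℝ := κ ^ 2 * ((1 / 4) ^ r / r.factorial) / (12 * r) with hc
  have hr0 : (0 : ℝ) < r := by exact_mod_cast (by omega : 0 < r)
  have hc0 : 0 < c := by positivity
  have hev : ∀ᶠ n : ℕ in atTop, (|Real.log (2 / q)| + Real.log 8) / c ≤ (n : ℝ) :=
    tendsto_natCast_atTop_atTop.eventually_ge_atTop _
  filter_upwards [hev, eventually_ge_atTop (4 * r)] with n hn hn4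
  have hn1 : (1 : ℝ) ≤ n := by exact_mod_cast (by omega : 1 ≤ n)
  have hlow : c * n ^ 2 ≤ κ ^ 2 * ((n / 2).choose r : ℝ) / (12 * n * r) := by
    have h1 := choose_half_lower hn4
    have h2 : (n : ℝ) ^ 3 ≤ (n : ℝ) ^ r := pow_le_pow_right₀ hn1 hr
    rw [le_div_iff₀ (by positivity)]
    calc c * n ^ 2 * (12 * n * r) = κ ^ 2 * ((1 / 4) ^ r / r.factorial * n ^ 3) := by
          rw [hc]
          field_simp
      _ ≤ κ ^ 2 * ((1 / 4) ^ r / r.factorial * n ^ r) := by gcongr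
      _ = κ ^ 2 * (((n : ℝ) / 4) ^ r / r.factorial) := by
          rw [div_pow, div_pow]
          ring
      _ ≤ _ := by gcongr
  rw [div_le_iff₀ hc0] at hn
  have hl8 : 0 ≤ Real.log 8 := Real.log_nonneg (by norm_num)
  have hexp : Real.log 8 + n * Real.log (2 / q) ≤ c * n ^ 2 := by
    have h1 := le_abs_self (Real.log (2 / q))
    have h2 : n * Real.log (2 / q) ≤ n * |Real.log (2 / q)| := by gcongr
    have h3 : Real.log 8 ≤ n * Real.log 8 := le_mul_of_one_le_left hl8 hn1
    have h4 := mul_le_mul_of_nonneg_left hn (by positivity : (0 : ℝ) ≤ n)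
    nlinarith
  have hfin : 8 * (2 / q) ^ n ≤
      Real.exp (κ ^ 2 * ((n / 2).choose r : ℝ) / (12 * n * r)) := by
    calc 8 * (2 / q) ^ n = Real.exp (Real.log 8 + n * Real.log (2 / q)) := by
          rw [Real.exp_add, Real.exp_log (by norm_num), Real.exp_nat_mul,
            Real.exp_log (by positivity)]
      _ ≤ _ := Real.exp_le_exp.2 (hexp.trans hlow)
  rw [Real.exp_neg, div_pow] at *
  set e := Real.exp (κ ^ 2 * ((n / 2).choose r : ℝ) / (12 * n * r)) with he
  have he0 : 0 < e := Real.exp_pos _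
  have hqn : 0 < q ^ n := by positivity
  have hfin2 : 8 * 2 ^ n ≤ e * q ^ n := by
    rw [← mul_div_assoc, div_le_iff₀ hqn] at hfin
    exact hfin
  have : 2 ^ n * (2 * e⁻¹) = 8 * 2 ^ n / (4 * e) := by
    field_simp
    norm_num
  rw [this, div_le_div_iff₀ (by positivity) (by norm_num)]
  nlinarith

theorem pow_le_mul_sq_pow_half {ρ : ℝ} (hρ : 1 ≤ ρ) (n : ℕ) :
    ρ ^ n ≤ ρ * (ρ ^ 2) ^ (n / 2) := by
  rw [← pow_mul, ← pow_succ']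
  exact pow_le_pow_right₀ hρ (by omega)

/-- The gain over the expectation is exponential in `n`. -/
theorem eventually_exp_le_maxHam_div {ε p : ℝ} (hε : 0 < ε) (hp : p ∈ Set.Ioo (0 : ℝ) 1) {r : ℕ}
    (hr : 3 ≤ r) :
    ∃ c : ℝ, 0 < c ∧ ∀ᶠ n : ℕ in atTop, (∃ m : ℕ, (m : ℝ) = p * (n.choose r : ℝ)) →
      (2 : ℝ) ^ (c * n) ≤ (maxHam r n p ε : ℝ) / expectedHam n p := by
  obtain ⟨hp0, hp1⟩ := hp
  have hr0 : (0 : ℝ) < r := by exact_mod_cast (by omega : 0 < r)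
  set η : ℝ := (1 - p) / r with hη
  have hη0 : 0 < η := div_pos (by linarith) hr0
  have hηr : η * r = 1 - p := div_mul_cancel₀ _ hr0.ne'
  set ρ : ℝ := Real.sqrt (1 + η ^ 2) with hρ
  have hρ2 : ρ ^ 2 = 1 + η ^ 2 := Real.sq_sqrt (by positivity)
  have hρ1 : 1 < ρ := by
    rw [hρ, Real.lt_sqrt zero_le_one]
    nlinarith [sq_pos_of_pos hη0]
  have hρ0 : 0 < ρ := by linarith
  -- `κ` is so small that the loss `(1 - 2κ / p) ^ n` in density costs less than the gain `ρ ^ n`.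
  set κ : ℝ := min (p * (1 - 1 / ρ) / 4) (ε / (3 * 4 ^ r)) with hκ
  have hρinv : 1 / ρ < 1 := (div_lt_one hρ0).2 hρ1
  have hκ0 : 0 < κ := by
    refine lt_min ?_ (by positivity)
    have : 0 < 1 - 1 / ρ := by linarith
    positivity
  have hκ1 : κ ≤ p * (1 - 1 / ρ) / 4 := min_le_left _ _
  have hκε : 3 * κ * 4 ^ r ≤ ε := by
    have : κ ≤ ε / (3 * 4 ^ r) := min_le_right _ _
    rw [le_div_iff₀ (by positivity)] at this
    linarith
  set q : ℝ := p - 2 * κ with hq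
  have hqρ : p / ρ < q := by
    have h1 : p / ρ = p * (1 / ρ) := by ring
    have h2 : 0 < p * (1 - 1 / ρ) := mul_pos hp0 (by linarith)
    rw [h1, hq]
    linarith
  have hq0 : 0 < q := (div_pos hp0 hρ0).trans hqρ
  set β : ℝ := q / p * ρ with hβ
  have hβ1 : 1 < β := by
    rw [div_lt_iff₀ hρ0] at hqρ
    rw [hβ, div_mul_eq_mul_div, one_lt_div hp0]
    exact hqρ
  have hβ0 : 0 < β := by linarith
  set b : ℝ := Real.sqrt β with hb
  have hb1 : 1 < b := by
    rw [hb, Real.lt_sqrt zero_le_one]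
    linarith
  have hb2 : b ^ 2 = β := Real.sq_sqrt hβ0.le
  have hb0 : 0 < b := by linarith
  refine ⟨Real.logb 2 b, Real.logb_pos (by norm_num) hb1, ?_⟩
  have hlim := tendsto_pow_const_div_const_pow_of_one_lt r hb1
  have hevb : ∀ᶠ n : ℕ in atTop, (n : ℝ) ^ r / b ^ n < 1 / ρ :=
    hlim.eventually_lt_const (by positivity)
  filter_upwards [hevb, eventually_two_pow_mul_exp_le hr hq0 hκ0, eventually_ge_atTop (4 * r)]
    with n hnb hbad hn4
  rintro ⟨m, hm⟩
  have hmain := RGraph.le_maxHam_mul (by omega) (by omega) hq0 hp1.le hη0.le (by linarith)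
    (by rw [hηr]; nlinarith [sq_nonneg (1 - p)]) hκ0 hbad
    (choose_le_four_pow_mul_choose_half hn4) (one_le_pow₀ (by norm_num)) hκε hm
  rw [← hq, ← hρ2] at hmain
  have hn0 : (0 : ℝ) < n := by exact_mod_cast (by omega : 0 < n)
  have hn1 : (1 : ℝ) ≤ n := by exact_mod_cast (by omega : 1 ≤ n)
  have hF : (0 : ℝ) < ((n - 1).factorial : ℝ) := by exact_mod_cast (n - 1).factorial_pos
  have hfac : (n.factorial : ℝ) = n * ((n - 1).factorial : ℝ) := by
    exact_mod_cast (Nat.mul_factorial_pred (by omega : n ≠ 0)).symm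
  have hbpow : (2 : ℝ) ^ (Real.logb 2 b * n) = b ^ n := by
    rw [Real.rpow_mul (by norm_num), Real.rpow_logb (by norm_num) (by norm_num) hb0,
      Real.rpow_natCast]
  rw [hbpow, expectedHam, le_div_iff₀ (by positivity)]
  have hpoly : ρ * (n : ℝ) ^ r ≤ b ^ n := by
    rw [div_lt_div_iff₀ (by positivity) hρ0] at hnb
    linarith
  have hgain : b ^ n * b ^ n * p ^ n ≤ ρ * (q ^ n * (ρ ^ 2) ^ (n / 2)) := by
    have h1 : b ^ n * b ^ n * p ^ n = q ^ n * ρ ^ n := by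
      rw [← mul_pow, ← sq, hb2, ← mul_pow, ← mul_pow, hβ]
      congr 1
      field_simp
    rw [h1]
    calc q ^ n * ρ ^ n ≤ q ^ n * (ρ * (ρ ^ 2) ^ (n / 2)) := by
          gcongr
          exact pow_le_mul_sq_pow_half hρ1.le n
      _ = _ := by ring
  have hnr : (0 : ℝ) < (n : ℝ) ^ r := by positivity
  refine le_of_mul_le_mul_right (le_trans ?_ hmain) hnr
  rw [hfac]
  refine le_of_mul_le_mul_left ?_ hρ0
  calc ρ * (b ^ n * (p ^ n * ((n - 1).factorial : ℝ) / 2) * n ^ r)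
      = (ρ * n ^ r) * (b ^ n * p ^ n * ((n - 1).factorial : ℝ) / 2) := by ring
    _ ≤ b ^ n * (b ^ n * p ^ n * ((n - 1).factorial : ℝ) / 2) := by gcongr
    _ = (b ^ n * b ^ n * p ^ n) * ((n - 1).factorial : ℝ) / 2 := by ring
    _ ≤ (ρ * (q ^ n * (ρ ^ 2) ^ (n / 2))) * ((n - 1).factorial : ℝ) / 2 := by gcongr
    _ ≤ (ρ * (q ^ n * (ρ ^ 2) ^ (n / 2))) * (n * ((n - 1).factorial : ℝ)) / 2 := by
        gcongr
        exact le_mul_of_one_le_left hF.le hn1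
    _ = _ := by ring

/-- An exponential gain covers every exponent function bounded by `1`. -/
theorem hamRatioLowerBound_of_le_one {ε p : ℝ} (hε : 0 < ε) (hp : p ∈ Set.Ioo (0 : ℝ) 1) {r : ℕ}
    (hr : 3 ≤ r) {γ : ℕ → ℝ} (hγ : ∀ n, γ n ≤ 1) : HamRatioLowerBound r p ε γ := by
  obtain ⟨c, hc, h⟩ := eventually_exp_le_maxHam_div hε hp hr
  obtain ⟨n₀, h⟩ := eventually_atTop.1 (h.and (eventually_ge_atTop 1))
  refine ⟨c, hc, n₀, fun n hn hm => le_trans ?_ ((h n hn).1 hm)⟩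
  have hn1 : (1 : ℝ) ≤ n := by exact_mod_cast (h n hn).2
  gcongr
  · norm_num
  · exact (Real.rpow_le_rpow_of_exponent_le hn1 (hγ n)).trans (Real.rpow_one _).le

theorem limitExponent_le_one (r : ℕ) : limitExponent r ≤ 1 := by
  rw [limitExponent]
  split_ifs <;> norm_num

theorem theorem1p2 (ε p : ℝ) (hε : 0 < ε) (hp : p ∈ Set.Ioo (0 : ℝ) 1) (r : ℕ) (hr : 3 ≤ r) :
    (∃ γ : ℕ → ℝ, Tendsto γ atTop (𝓝 (limitExponent r)) ∧ HamRatioLowerBound r p ε γ) ∧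
      ∀ δ : ℝ, 0 < δ → HamRatioLowerBound r p ε (fun _ => limitExponent r - 3 * δ) := by
  refine ⟨⟨fun _ => limitExponent r, tendsto_const_nhds,
    hamRatioLowerBound_of_le_one hε hp hr fun _ => limitExponent_le_one r⟩, fun δ hδ =>
    hamRatioLowerBound_of_le_one hε hp hr fun _ => ?_⟩
  linarith [limitExponent_le_one r]
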